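/- Let $\Gamma$ be a finite game: a finite set $N$ of players, for each $i\in N$ a nonempty finite set $C_i$ of pure strategies, and utility functions $U_i : C=\prod_{j\in N} C_j\to\mathbb{R}$, extended to mixed strategies by expectation. A probability distribution $\mu$ on $C$ is a correlated equilibrium if $\sum_{c_{-i}\in C_{-i}}\mu(c)\,[U_i(c_{-i},d_i)-U_i(c)]\le 0$ for all $i\in N$ and all $c_i,d_i\in C_i$, where $c=(c_{-i},c_i)$. Then: (1) There exists a Nash equilibrium $\sigma$ in mixed strategies such that, for every player $i$ and every pure strategy $c_i\in C_i$ that has marginal probability zero in all correlated equilibria of $\Gamma$, $c_i$ is not a best response to $\sigma_{-i}$. (2) Consequently, if $\Gamma$ has a unique correlated equilibrium $\mu$, then $\mu$ is a quasi-strict Nash equilibrium: $\mu$ is the product distribution $\mu(c)=\prod_{i\in N}\sigma_i(c_i)$ of a Nash equilibrium $\sigma$ such that, for every player $i$, every pure best response to $\sigma_{-i}$ has positive probability in $\sigma_i$. -/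

import Mathlib

/-! A finite game is given by a finite type `N` of players, a nonempty finite type `C i` of pure
strategies for each player `i`, and utility functions `U i : (∀ j, C j) → ℝ`. Mixed strategies of
player `i` and correlated strategies are points of `stdSimplex ℝ (C i)` and of
`stdSimplex ℝ (∀ i, C i)` respectively. -/

namespace FiniteGame

variable {N : Type*} [Fintype N] [DecidableEq N] {C : N → Type*}
  [∀ i, Fintype (C i)] [∀ i, DecidableEq (C i)]

/-- The probability of the pure strategy profile `c` when each player `i` independently
plays `σ i`. -/
def profileProb (σ : ∀ i, C i → ℝ) : (∀ i, C i) → ℝ :=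
  fun c => ∏ i, σ i (c i)

/-- The expected utility of player `i` under the profile `σ`. -/
def expectedUtility (U : N → (∀ i, C i) → ℝ) (i : N) (σ : ∀ i, C i → ℝ) : ℝ :=
  ∑ c, profileProb σ c * U i c

/-- The pure strategy `a`, seen as a mixed strategy. -/
def pureStrategy {i : N} (a : C i) : C i → ℝ := Pi.single a 1

/-- The mixed strategy `τ` of player `i` is a best response to the mixed strategies `σ j`, `j ≠ i`,
of the other players (the `i`-component of `σ` is overwritten and plays no role). -/
def IsBestResponse (U : N → (∀ i, C i) → ℝ) (σ : ∀ i, C i → ℝ) (i : N) (τ : C i → ℝ) : Prop :=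
  τ ∈ stdSimplex ℝ (C i) ∧
    ∀ τ' ∈ stdSimplex ℝ (C i),
      expectedUtility U i (Function.update σ i τ') ≤ expectedUtility U i (Function.update σ i τ)

/-- `σ` is a Nash equilibrium in mixed strategies. -/
def IsNashEquilibrium (U : N → (∀ i, C i) → ℝ) (σ : ∀ i, C i → ℝ) : Prop :=
  (∀ i, σ i ∈ stdSimplex ℝ (C i)) ∧ ∀ i, IsBestResponse U σ i (σ i)

/-- `σ` is a quasi-strict Nash equilibrium: every pure best response to `σ_{-i}` has positive
probability in `σ i`. -/
def IsQuasiStrict (U : N → (∀ i, C i) → ℝ) (σ : ∀ i, C i → ℝ) : Prop :=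
  IsNashEquilibrium U σ ∧ ∀ i, ∀ a : C i, IsBestResponse U σ i (pureStrategy a) → 0 < σ i a

/-- `μ` is a correlated equilibrium. The sum over `c_{-i}` with `c_i = a` fixed is written as the
sum over all profiles `c` with `c i = a`. -/
def IsCorrelatedEquilibrium (U : N → (∀ i, C i) → ℝ) (μ : (∀ i, C i) → ℝ) : Prop :=
  μ ∈ stdSimplex ℝ (∀ i, C i) ∧
    ∀ i, ∀ a d : C i,
      ∑ c : (∀ j, C j) with c i = a, μ c * (U i (Function.update c i d) - U i c) ≤ 0

/-- The marginal probability of the pure strategy `a` of player `i` in `μ`. -/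
def marginal (μ : (∀ i, C i) → ℝ) (i : N) (a : C i) : ℝ :=
  ∑ c : (∀ j, C j) with c i = a, μ c

end FiniteGame

/-! Correlated equilibria are cut out by linear inequalities. Duality
(`exists_strictly_complementary_deviationGain`) yields deviation rates `α i a d ≥ 0` whose total
gain is nonnegative at every profile and positive at every profile that is null in all correlated
equilibria. Read `α i` as the rates of a Markov chain on `C i` and confine each player to the
stationary distributions of her chain. These form compact convex sets, so the confined game has an
equilibrium `σ` (`exists_equilibrium_of_isCompact_convex`, which rests on Brouwer's theorem for
Lipschitz maps).

When the opponents of `i` are stationary, their terms in the expected total gain vanish, so the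
payoff of `i` is subharmonic for her chain. Some stationary distribution then lives on the
maximizers of that payoff (`exists_stationary_of_subharmonic`); confinement therefore costs nothing
and `σ` is a Nash equilibrium. If `a` has marginal zero in all correlated equilibria, the drift of
the payoff at `a` is positive, so some `d` beats `a`.

Since `σ` induces a correlated equilibrium, uniqueness identifies `μ` with it, and the strategies
unused by `σ` are those of marginal zero. -/

/-! ### Farkas' lemma -/

/-- **Farkas' lemma** for finitely many linear functionals. -/
theorem exists_nonneg_sum_smul_of_imp_nonpos_fin {W : Type*} [AddCommGroup W] [Module ℝ W]
    (n : ℕ) (A : Fin n → W →ₗ[ℝ] ℝ) (B : W →ₗ[ℝ] ℝ)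
    (h : ∀ x, (∀ k, A k x ≤ 0) → B x ≤ 0) :
    ∃ w : Fin n → ℝ, (∀ k, 0 ≤ w k) ∧ B = ∑ k, w k • A k := by
  induction n generalizing B with
  | zero =>
    refine ⟨0, fun _ => le_rfl, ?_⟩
    ext x
    have h1 := h x (fun k => k.elim0)
    have h2 := h (-x) (fun k => k.elim0)
    simp only [map_neg] at h2
    simp
    linarith
  | succ n ih =>
    by_cases hB : ∀ x, (∀ k : Fin n, A k.castSucc x ≤ 0) → B x ≤ 0
    · obtain ⟨w, hw, e⟩ := ih (fun k => A k.castSucc) B hB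
      refine ⟨Fin.snoc w 0, fun k => ?_, ?_⟩
      · refine Fin.lastCases ?_ (fun k => ?_) k <;> simp [hw]
      · simp [Fin.sum_univ_castSucc, e]
    · push Not at hB
      obtain ⟨y, hy, hBy⟩ := hB
      have hp : 0 < A (Fin.last n) y := by
        by_contra hc
        refine absurd (h y fun k => ?_) (not_le.2 hBy)
        refine Fin.lastCases (not_lt.1 hc) hy k
      set p := A (Fin.last n) y with hpdef
      -- Subtracting multiples of the last functional makes every functional vanish at `y`; the
      -- induction hypothesis then amounts to testing `h` on the kernel of the last functional,
      -- reached by projecting along `y`.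
      obtain ⟨w, hw, e⟩ := ih (fun k => A k.castSucc - (A k.castSucc y / p) • A (Fin.last n))
        (B - (B y / p) • A (Fin.last n)) (fun x hx => by
          have := h (x - (A (Fin.last n) x / p) • y) (fun k => by
            refine Fin.lastCases ?_ (fun k => ?_) k
            · simp [← hpdef, hp.ne']
            · have := hx k
              simp only [LinearMap.sub_apply, LinearMap.smul_apply, smul_eq_mul, map_sub,
                map_smul] at this ⊢
              convert this using 2
              ring)
          simp only [LinearMap.sub_apply, LinearMap.smul_apply, smul_eq_mul, map_sub,
            map_smul] at this ⊢
          convert this using 2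
          ring)
      refine ⟨Fin.snoc w (B y / p - ∑ k, w k * (A k.castSucc y / p)), fun k => ?_, ?_⟩
      · refine Fin.lastCases ?_ (fun k => ?_) k
        · simp only [Fin.snoc_last]
          have h1 : ∑ k, w k * (A k.castSucc y / p) ≤ 0 :=
            Finset.sum_nonpos fun k _ => mul_nonpos_of_nonneg_of_nonpos (hw k)
              (div_nonpos_of_nonpos_of_nonneg (hy k) hp.le)
          have h2 : 0 < B y / p := div_pos hBy hp
          linarith
        · simp [hw]
      · ext x
        have := LinearMap.congr_fun e x
        simp only [LinearMap.sub_apply, LinearMap.smul_apply, smul_eq_mul, LinearMap.sum_apply,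
          mul_sub, Finset.sum_sub_distrib] at this
        simp only [Fin.sum_univ_castSucc, Fin.snoc_castSucc, Fin.snoc_last, LinearMap.add_apply,
          LinearMap.sum_apply, LinearMap.smul_apply, smul_eq_mul, sub_mul, Finset.sum_mul]
        have h3 : ∑ k, w k * (A k.castSucc y / p * A (Fin.last n) x)
            = ∑ k, w k * (A k.castSucc y / p) * A (Fin.last n) x :=
          Finset.sum_congr rfl fun k _ => by ring
        linarith

/-- **Farkas' lemma**: a linear inequality implied by finitely many homogeneous linear inequalities
is a nonnegative combination of them. -/
theorem exists_nonneg_sum_smul_of_imp_nonpos {W ι : Type*} [AddCommGroup W] [Module ℝ W]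
    [Fintype ι] (A : ι → W →ₗ[ℝ] ℝ) (B : W →ₗ[ℝ] ℝ) (h : ∀ x, (∀ k, A k x ≤ 0) → B x ≤ 0) :
    ∃ w : ι → ℝ, (∀ k, 0 ≤ w k) ∧ B = ∑ k, w k • A k := by
  let e := Fintype.equivFin ι
  obtain ⟨w, hw, hB⟩ := exists_nonneg_sum_smul_of_imp_nonpos_fin _ (fun k => A (e.symm k)) B
    (fun x hx => h x fun k => by simpa using hx (e k))
  refine ⟨fun k => w (e k), fun k => hw _, hB.trans ?_⟩
  exact (Fintype.sum_equiv e _ _ fun k => by simp).symm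

/-! ### Nearest point projections -/

section Projection

variable {E : Type*} [NormedAddCommGroup E] [InnerProductSpace ℝ E]

/-- The nearest point projection onto a nonempty complete convex set. -/
theorem exists_lipschitzWith_one_projection {K : Set E} (ne : K.Nonempty) (hK : IsComplete K)
    (hc : Convex ℝ K) :
    ∃ P : E → E, (∀ x, P x ∈ K) ∧ LipschitzWith 1 P ∧
      ∀ x, ∀ z ∈ K, inner ℝ (x - P x) (z - P x) ≤ 0 := by
  choose P hP hP' using exists_norm_eq_iInf_of_complete_convex ne hK hc
  have hi : ∀ x, ∀ z ∈ K, inner ℝ (x - P x) (z - P x) ≤ 0 := fun x =>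
    (norm_eq_iInf_iff_real_inner_le_zero hc (hP x)).1 (hP' x)
  refine ⟨P, hP, LipschitzWith.of_dist_le_mul fun x y => ?_, hi⟩
  rw [dist_eq_norm, dist_eq_norm, NNReal.coe_one, one_mul]
  have h1 := hi x _ (hP y)
  have h2 := hi y _ (hP x)
  have h3 : ‖P x - P y‖ * ‖P x - P y‖ ≤ ‖x - y‖ * ‖P x - P y‖ := by
    refine le_trans ?_ (real_inner_le_norm (x - y) (P x - P y))
    rw [← real_inner_self_eq_norm_mul_norm]
    have : inner ℝ (x - y) (P x - P y) = inner ℝ (P x - P y) (P x - P y)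
        - inner ℝ (x - P x) (P y - P x) - inner ℝ (y - P y) (P x - P y) := by
      simp only [inner_sub_left, inner_sub_right]
      ring
    linarith
  rcases (norm_nonneg (P x - P y)).eq_or_lt with h | h
  · rw [← h]; positivity
  · exact le_of_mul_le_mul_right h3 h

theorem eq_of_inner_sub_projection_nonpos {K : Set E} {x y z : E} (hy : y ∈ K) (hz : z ∈ K)
    (h₁ : ∀ w ∈ K, inner ℝ (x - y) (w - y) ≤ 0) (h₂ : ∀ w ∈ K, inner ℝ (x - z) (w - z) ≤ 0) :
    y = z := by
  have h1 := h₁ z hz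
  have h2 := h₂ y hy
  have : inner ℝ (y - z) (y - z) = inner ℝ (x - y) (z - y) + inner ℝ (x - z) (y - z) := by
    simp only [inner_sub_left, inner_sub_right]
    ring
  exact sub_eq_zero.1 (inner_self_eq_zero (𝕜 := ℝ) |>.1
    (le_antisymm (by linarith) real_inner_self_nonneg))

/-- The radial projection onto a closed ball. -/
theorem exists_lipschitzWith_one_ball_projection [CompleteSpace E] {ρ : ℝ} (hρ : 0 < ρ) :
    ∃ P : E → E, LipschitzWith 1 P ∧ (∀ x, ‖P x‖ ≤ ρ) ∧ (∀ x, ‖x‖ ≤ ρ → P x = x) ∧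
      ∀ x, ρ ≤ ‖x‖ → P x = (ρ / ‖x‖) • x := by
  obtain ⟨P, hP, hL, hi⟩ := exists_lipschitzWith_one_projection
    (K := Metric.closedBall (0 : E) ρ) ⟨0, by simp [hρ.le]⟩ Metric.isClosed_closedBall.isComplete
    (convex_closedBall _ _)
  refine ⟨P, hL, fun x => by simpa using hP x, fun x hx => ?_, fun x hx => ?_⟩
  · exact eq_of_inner_sub_projection_nonpos (hP x) (by simpa using hx) (hi x) (by simp)
  · have hx0 : 0 < ‖x‖ := hρ.trans_le hx
    refine eq_of_inner_sub_projection_nonpos (hP x) ?_ (hi x) fun w hw => ?_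
    · simp [norm_smul, abs_of_pos hρ, hx0.ne']
    · have hw : ‖w‖ ≤ ρ := by simpa using hw
      have e : x - (ρ / ‖x‖) • x = (1 - ρ / ‖x‖) • x := by rw [sub_smul, one_smul]
      rw [e, inner_smul_left, inner_sub_right, inner_smul_right, real_inner_self_eq_norm_mul_norm]
      refine mul_nonpos_of_nonneg_of_nonpos ?_ ?_
      · simpa using (div_le_one hx0).2 hx
      · have h1 := real_inner_le_norm x w
        have h2 : ρ / ‖x‖ * (‖x‖ * ‖x‖) = ρ * ‖x‖ := by field_simp
        rw [h2]
        nlinarith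

end Projection

/-! ### Determinants of perturbations of the identity -/

/-- The determinant of `1 + A` is a fixed affine combination of the determinants of `1 + v j • A`
for any `finrank + 1` distinct nodes `v j`. -/
theorem det_one_add_eq_sum_det_one_add_smul {E : Type*} [NormedAddCommGroup E] [NormedSpace ℝ E]
    [FiniteDimensional ℝ E] {v : Fin (Module.finrank ℝ E + 1) → ℝ} (hv : Function.Injective v) :
    ∃ w : Fin (Module.finrank ℝ E + 1) → ℝ, ∑ j, w j = 1 ∧ ∀ A : E →L[ℝ] E,
      (ContinuousLinearMap.id ℝ E + A).det
        = ∑ j, w j * (ContinuousLinearMap.id ℝ E + v j • A).det := by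
  -- The determinant of `1 + t • A` is a polynomial in `t` of degree at most `finrank`; the weights
  -- are those of Lagrange interpolation at `t = 1`.
  refine ⟨fun j => (Lagrange.basis Finset.univ v j).eval 1, ?_, fun A => ?_⟩
  · rw [← Polynomial.eval_finsetSum, Lagrange.sum_basis hv.injOn Finset.univ_nonempty]
    simp
  · let b := Module.finBasis ℝ E
    let M : Matrix (Fin (Module.finrank ℝ E)) (Fin (Module.finrank ℝ E)) ℝ :=
      LinearMap.toMatrix b b A.toLinearMap
    let p : Polynomial ℝ := ((Polynomial.X : Polynomial ℝ) • M.map (Polynomial.C : ℝ →+* Polynomial ℝ)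
      + (1 : Matrix (Fin (Module.finrank ℝ E)) (Fin (Module.finrank ℝ E)) ℝ).map
        (Polynomial.C : ℝ →+* Polynomial ℝ)).det
    have hp : ∀ t : ℝ, p.eval t = (ContinuousLinearMap.id ℝ E + t • A).det := fun t => by
      have h1 : (ContinuousLinearMap.id ℝ E + t • A).det
          = (1 + t • M).det := by
        rw [ContinuousLinearMap.det, ← LinearMap.det_toMatrix b]
        congr 1
        simp [M]
      rw [h1, ← Polynomial.coe_evalRingHom, RingHom.map_det]
      congr 1
      ext i j
      by_cases h : i = j <;> simp [h, add_comm, mul_comm t]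
    have hdeg : p.degree < (Finset.univ : Finset (Fin (Module.finrank ℝ E + 1))).card := by
      refine (Polynomial.degree_le_natDegree).trans_lt ?_
      have := Polynomial.natDegree_det_X_add_C_le M 1
      simp only [Fintype.card_fin] at this
      simp only [Finset.card_univ, Fintype.card_fin]
      exact_mod_cast Nat.lt_succ_of_le this
    have h1 := hp 1
    rw [one_smul] at h1
    rw [← h1, Lagrange.eq_interpolate (s := Finset.univ) hv.injOn hdeg, Lagrange.interpolate_apply,
      Polynomial.eval_finsetSum]
    refine Finset.sum_congr rfl fun j _ => ?_
    rw [Polynomial.eval_mul, Polynomial.eval_C, hp, mul_comm]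

/-- A kernel vector of `1 + s • A` with `0 ≤ s ≤ t` would be strictly shorter than itself, so the
determinant keeps the sign it has at `s = 0`. -/
theorem det_id_add_smul_pos {E : Type*} [NormedAddCommGroup E] [NormedSpace ℝ E]
    [FiniteDimensional ℝ E] (A : E →L[ℝ] E) {t : ℝ} (ht : 0 ≤ t) (h : t * ‖A‖ < 1) :
    0 < (ContinuousLinearMap.id ℝ E + t • A).det := by
  have hne : ∀ s ∈ Set.Icc 0 t, (ContinuousLinearMap.id ℝ E + s • A).det ≠ 0 := fun s hs h0 => by
    obtain ⟨x, hx, hx0⟩ := (LinearMap.hasEigenvalue_zero_tfae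
      (ContinuousLinearMap.id ℝ E + s • A).toLinearMap).out 3 5 |>.1 h0
    have h1 : x = -(s • A x) := by
      have : x + s • A x = 0 := by simpa using hx0
      exact eq_neg_of_add_eq_zero_left this
    have h2 : ‖x‖ ≤ t * ‖A‖ * ‖x‖ := by
      calc ‖x‖ = s * ‖A x‖ := by
            conv_lhs => rw [h1]
            rw [norm_neg, norm_smul, Real.norm_of_nonneg hs.1]
        _ ≤ t * (‖A‖ * ‖x‖) := by
            gcongr
            exacts [hs.2, A.le_opNorm x]
        _ = _ := by ring
    have h3 : 0 < ‖x‖ := norm_pos_iff.2 hx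
    nlinarith
  by_contra hc
  have hcont : Continuous fun s : ℝ => (ContinuousLinearMap.id ℝ E + s • A).det :=
    ContinuousLinearMap.continuous_det.comp (by fun_prop)
  have h0 : (0 : ℝ) ∈ Set.Icc ((ContinuousLinearMap.id ℝ E + t • A).det)
      ((ContinuousLinearMap.id ℝ E + (0 : ℝ) • A).det) :=
    ⟨not_lt.1 hc, by simp [ContinuousLinearMap.det]⟩
  obtain ⟨s, hs, hs0⟩ := intermediate_value_Icc' ht hcont.continuousOn h0
  exact hne s hs hs0

/-! ### No Lipschitz retraction onto the sphere -/

section NoRetraction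

open MeasureTheory Metric Set

variable {E : Type*} [NormedAddCommGroup E] [InnerProductSpace ℝ E]

/-- Differentiating the squared norm shows that the range of `f'` is orthogonal to `f x ≠ 0`, so
`f'` is not onto. -/
theorem det_fderiv_eq_zero_of_norm_eventually_const [FiniteDimensional ℝ E] {f : E → E}
    {f' : E →L[ℝ] E} {x : E} {R : ℝ} (hR : 0 < R) (hf : HasFDerivAt f f' x)
    (h : ∀ᶠ y in nhds x, ‖f y‖ = R) : f'.det = 0 := by
  by_contra hdet
  have h1 : HasFDerivAt (fun y => inner ℝ (f y) (f y)) (0 : E →L[ℝ] ℝ) x := by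
    refine (hasFDerivAt_const (R ^ 2) x).congr_of_eventuallyEq ?_
    filter_upwards [h] with y hy
    rw [real_inner_self_eq_norm_sq, hy]
  have h2 := (hf.inner ℝ hf).unique h1
  obtain ⟨v, hv⟩ := ((LinearMap.equivOfDetNeZero f'.toLinearMap hdet).surjective) (f x)
  have hv : f' v = f x := hv
  have h3 := congrArg (fun g : E →L[ℝ] ℝ => g v) h2
  simp [hv, h.self_of_nhds] at h3
  exact hR.ne' h3

theorem bijective_add_smul_of_lipschitzWith [CompleteSpace E] {φ : E → E} {L : NNReal}
    (hφ : LipschitzWith L φ) {t : NNReal} (ht : t * L < 1) :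
    Function.Bijective fun x => x + t • φ x := by
  have ha : ApproximatesLinearOn (fun x => x + t • φ x)
      ((ContinuousLinearEquiv.refl ℝ E : E ≃L[ℝ] E) : E →L[ℝ] E) univ (t * L) := by
    intro x _ y _
    have h1 : x + t • φ x - (y + t • φ y) - (x - y) = (t : ℝ) • (φ x - φ y) := by
      rw [smul_sub, NNReal.smul_def, NNReal.smul_def]; abel
    change ‖x + t • φ x - (y + t • φ y) - (x - y)‖ ≤ _
    rw [h1, norm_smul, Real.norm_of_nonneg t.coe_nonneg, NNReal.coe_mul, mul_assoc]
    gcongr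
    exact hφ.norm_sub_le x y
  have hc : Subsingleton E ∨
      t * L < ‖((ContinuousLinearEquiv.refl ℝ E).symm : E →L[ℝ] E)‖₊⁻¹ := by
    rcases subsingleton_or_nontrivial E with h | h
    · exact Or.inl h
    · right
      simpa using ht
  refine ⟨fun x y hxy => ?_, ha.surjective hc⟩
  simpa using ha.injective hc (a₁ := ⟨x, mem_univ x⟩) (a₂ := ⟨y, mem_univ y⟩) hxy

theorem image_ball_eq_of_bijective {F : Type*} [NormedAddCommGroup F] {f : F → F} {R : ℝ}
    (hf : Function.Bijective f) (h : ∀ x, R ≤ ‖x‖ → f x = x) : f '' ball 0 R = ball 0 R := by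
  have h1 : f '' (ball 0 R)ᶜ = (ball 0 R)ᶜ := by
    have : EqOn f id (ball 0 R)ᶜ := fun x hx => h x (by simpa using hx)
    rw [this.image_eq, image_id]
  rw [image_compl_eq hf] at h1
  exact compl_injective h1

/-- There is no Lipschitz retraction of a closed ball onto its boundary. -/
theorem not_lipschitz_retraction_ball [FiniteDimensional ℝ E] {φ : E → E} {L : NNReal} {R : ℝ}
    (hφ : LipschitzWith L φ) (hR : 0 < R) (h0 : ∀ x, R ≤ ‖x‖ → φ x = 0)
    (h1 : ∀ x, ‖x‖ ≤ R → ‖x + φ x‖ = R) : False := by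
  borelize E
  -- The Hausdorff measure of top dimension is a Haar measure, and it directly bounds the measure of
  -- Lipschitz images of null sets.
  let μ : Measure E := μH[Module.finrank ℝ E]
  have : μ.IsAddHaarMeasure := isAddHaarMeasure_hausdorffMeasure
  let D : Set E := {x | DifferentiableAt ℝ φ x}
  have hDm : MeasurableSet D := measurableSet_of_differentiableAt ℝ φ
  have hD0 : μ Dᶜ = 0 := hφ.ae_differentiableAt
  let s : Set E := ball 0 R ∩ D
  have hs : MeasurableSet s := isOpen_ball.measurableSet.inter hDm
  have hd : ∀ t : ℝ, ∀ x ∈ s, HasFDerivAt (fun x => x + t • φ x)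
      (ContinuousLinearMap.id ℝ E + t • fderiv ℝ φ x) x := fun t x hx =>
    (hasFDerivAt_id x).add ((DifferentiableAt.hasFDerivAt hx.2).const_smul t)
  have hsub : s ⊆ ball 0 R := inter_subset_left
  -- For small `t` the map `x + t • φ x` permutes the ball, so its Jacobian integrates to the volume
  -- of the ball. Interpolation in `t` carries this to `t = 1`, where the Jacobian vanishes.
  have key : ∀ t : NNReal, t * L < 1 →
      IntegrableOn (fun x => (ContinuousLinearMap.id ℝ E + (t : ℝ) • fderiv ℝ φ x).det) s μ ∧
      ∫ x in s, (ContinuousLinearMap.id ℝ E + (t : ℝ) • fderiv ℝ φ x).det ∂μ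
        = μ.real (ball (0 : E) R) := by
    intro t ht
    have hb := bijective_add_smul_of_lipschitzWith hφ ht
    let f : E → E := fun x => x + (t : ℝ) • φ x
    change Function.Bijective f at hb
    have hfL : LipschitzWith (1 + t * L) f := by
      refine LipschitzWith.id.add (LipschitzWith.of_dist_le_mul fun x y => ?_)
      rw [dist_smul₀, Real.norm_of_nonneg t.coe_nonneg, NNReal.coe_mul, mul_assoc]
      gcongr
      exact hφ.dist_le_mul x y
    have him : f '' ball 0 R = ball 0 R :=
      image_ball_eq_of_bijective hb fun x hx => by simp [f, h0 x hx]
    have hnull : μ (f '' Dᶜ) = 0 := by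
      refine le_antisymm ((hfL.hausdorffMeasure_image_le (Nat.cast_nonneg _) _).trans ?_) bot_le
      change _ * μ Dᶜ ≤ 0
      rw [hD0, mul_zero]
    have hfs : f '' s =ᵐ[μ] ball (0 : E) R := by
      have hss : f '' s ⊆ ball 0 R := (image_mono hsub).trans him.subset
      refine Filter.EventuallyLE.antisymm (ae_of_all _ hss) ?_
      refine ae_le_set.2 (measure_mono_null ?_ hnull)
      rintro _ ⟨hy, hy'⟩
      rw [← him] at hy
      obtain ⟨x, hx, rfl⟩ := hy
      exact ⟨x, fun hxD => hy' ⟨x, ⟨hx, hxD⟩, rfl⟩, rfl⟩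
    have habs : ∀ x ∈ s, |(ContinuousLinearMap.id ℝ E + (t : ℝ) • fderiv ℝ φ x).det| • (1 : ℝ)
        = (ContinuousLinearMap.id ℝ E + (t : ℝ) • fderiv ℝ φ x).det := fun x _ => by
      rw [smul_eq_mul, mul_one, abs_of_pos]
      refine det_id_add_smul_pos _ t.coe_nonneg (lt_of_le_of_lt ?_ (NNReal.coe_lt_coe.2 ht))
      rw [NNReal.coe_mul]
      gcongr
      exact norm_fderiv_le_of_lipschitz ℝ hφ
    have hfd : ∀ x ∈ s, HasFDerivWithinAt f
        (ContinuousLinearMap.id ℝ E + (t : ℝ) • fderiv ℝ φ x) s x :=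
      fun x hx => (hd t x hx).hasFDerivWithinAt
    constructor
    · have := (integrableOn_image_iff_integrableOn_abs_det_fderiv_smul μ hs hfd hb.1.injOn
        (fun _ => (1 : ℝ))).1 (by
          rw [integrableOn_congr_set_ae hfs]
          exact integrableOn_const measure_ball_lt_top.ne)
      exact this.congr_fun habs hs
    · rw [← setIntegral_congr_fun hs habs,
        ← integral_image_eq_integral_abs_det_fderiv_smul μ hs hfd hb.1.injOn (fun _ => (1 : ℝ)),
        setIntegral_congr_set hfs]
      simp
  let n := Module.finrank ℝ E
  let v : Fin (n + 1) → NNReal := fun j => (1 / (((j : ℕ) + 1) * (L + 1)) : NNReal)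
  have hv : Function.Injective fun j => (v j : ℝ) := fun i j hij => by
    have h : v i = v j := NNReal.coe_injective hij
    simp only [v, one_div, inv_inj] at h
    have h2 := mul_right_cancel₀ (by positivity) h
    exact Fin.ext (by exact_mod_cast add_right_cancel h2)
  have hvL : ∀ j, v j * L < 1 := fun j => by
    simp only [v, one_div]
    rw [inv_mul_lt_iff₀ (by positivity), mul_one]
    calc L < L + 1 := lt_add_one L
      _ ≤ ((j : ℕ) + 1) * (L + 1) := le_mul_of_one_le_left' le_add_self
  obtain ⟨w, hw, hdet⟩ := det_one_add_eq_sum_det_one_add_smul (E := E) hv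
  have hzero : ∀ x ∈ s, (ContinuousLinearMap.id ℝ E + fderiv ℝ φ x).det = 0 := fun x hx => by
    refine det_fderiv_eq_zero_of_norm_eventually_const hR (f := fun x => x + φ x)
      (by simpa only [one_smul] using hd 1 x hx) ?_
    filter_upwards [isOpen_ball.mem_nhds hx.1] with y hy
    exact h1 y (mem_ball_zero_iff.1 hy).le
  have hcalc : (0 : ℝ) = μ.real (ball (0 : E) R) := by
    calc (0 : ℝ) = ∫ x in s, (ContinuousLinearMap.id ℝ E + fderiv ℝ φ x).det ∂μ := by
          rw [setIntegral_congr_fun hs hzero]; simp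
      _ = ∑ j, w j * ∫ x in s, (ContinuousLinearMap.id ℝ E + (v j : ℝ) • fderiv ℝ φ x).det ∂μ := by
          rw [integral_congr_ae (ae_of_all _ fun x => hdet (fderiv ℝ φ x)),
            integral_finsetSum _ fun j _ => (key (v j) (hvL j)).1.const_mul _]
          exact Finset.sum_congr rfl fun j _ => integral_const_mul _ _
      _ = μ.real (ball (0 : E) R) := by
          simp_rw [fun j => (key (v j) (hvL j)).2, ← Finset.sum_mul, hw, one_mul]
  have hpos : 0 < μ.real (ball (0 : E) R) :=
    ENNReal.toReal_pos (measure_ball_pos μ 0 hR).ne' measure_ball_lt_top.ne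
  exact hpos.ne hcalc

end NoRetraction

/-! ### Brouwer's theorem and variational inequalities -/

section FixedPoint

open Metric Set

variable {E : Type*} [NormedAddCommGroup E] [InnerProductSpace ℝ E]

/-- A Lipschitz map that is radial outside a ball vanishes somewhere in that ball. -/
theorem exists_eq_zero_of_lipschitzWith [FiniteDimensional ℝ E] {h : E → E} {L : NNReal} {R : ℝ}
    (hh : LipschitzWith L h) (hR : 0 < R) (hid : ∀ x, ‖x‖ = R → h x = x) : ∃ x, h x = 0 := by
  by_contra! hne
  obtain ⟨δ, hδ, hδR, hδh⟩ : ∃ δ > 0, δ ≤ R ∧ ∀ x, ‖x‖ ≤ R → δ ≤ ‖h x‖ := by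
    obtain ⟨x, -, hx⟩ := (isCompact_closedBall (0 : E) R).exists_isMinOn ⟨0, by simp [hR.le]⟩
      hh.continuous.norm.continuousOn
    refine ⟨min ‖h x‖ R, lt_min (norm_pos_iff.2 (hne x)) hR, min_le_right _ _, fun y hy => ?_⟩
    exact (min_le_left _ _).trans (hx (by simpa using hy))
  obtain ⟨P, hP, -, hPid, hPout⟩ := exists_lipschitzWith_one_ball_projection (E := E) hR
  obtain ⟨Q, hQ, -, -, hQout⟩ := exists_lipschitzWith_one_ball_projection (E := E) hδ
  have hPR : ∀ x, R ≤ ‖x‖ → ‖P x‖ = R := fun x hx => by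
    have : 0 < ‖x‖ := hR.trans_le hx
    rw [hPout x hx, norm_smul, norm_div, norm_norm, Real.norm_of_nonneg hR.le]
    field_simp
  -- Projecting to the ball of radius `δ` normalizes `h x` without dividing by its norm, which keeps
  -- the map Lipschitz on all of `E`.
  let r : E → E := fun x => (R / δ) • Q (h x)
  have hrn : ∀ x, ‖x‖ ≤ R → ‖r x‖ = R := fun x hx => by
    have h1 := hδh x hx
    have h2 : 0 < ‖h x‖ := hδ.trans_le h1
    simp only [r]
    rw [hQout _ h1, norm_smul, norm_smul, norm_div, norm_div, norm_norm,
      Real.norm_of_nonneg hR.le, Real.norm_of_nonneg hδ.le]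
    field_simp
  have hrid : ∀ x, ‖x‖ = R → r x = x := fun x hx => by
    simp only [r]
    rw [hid x hx, hQout x (hx ▸ hδR), smul_smul, hx]
    have : R / δ * (δ / R) = 1 := by field_simp
    rw [this, one_smul]
  have hrL : LipschitzWith (‖R / δ‖₊ * (1 * L)) r :=
    (lipschitzWith_smul (R / δ)).comp (hQ.comp hh)
  refine not_lipschitz_retraction_ball (φ := fun x => r (P x) - P x)
    ((hrL.comp hP).sub hP) hR (fun x hx => ?_) fun x hx => ?_
  · rw [hrid _ (hPR x hx), sub_self]
  · rw [hPid x hx, add_sub_cancel, hrn x hx]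

/-- **Brouwer's fixed point theorem** for bounded Lipschitz maps. -/
theorem exists_fixedPoint_of_lipschitzWith [FiniteDimensional ℝ E] {T : E → E} {L : NNReal} {R : ℝ}
    (hT : LipschitzWith L T) (hb : ∀ x, ‖T x‖ ≤ R) : ∃ x, T x = x := by
  wlog hR : 0 < R generalizing R
  · exact this (fun x => (hb x).trans ((not_lt.1 hR).trans zero_le_one)) zero_lt_one
  -- A cutoff equal to 1 for `‖x‖ ≤ R` and to 0 for `‖x‖ ≥ 2 * R`: then `x - s x • T x` is the
  -- identity on the sphere of radius `2 * R`, and its zeros lie where `s = 1`.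
  let s : E → ℝ := fun x => max 0 (min 1 (2 - ‖x‖ / R))
  have hs0 : ∀ x, 0 ≤ s x := fun x => le_max_left _ _
  have hs1 : ∀ x, s x ≤ 1 := fun x => max_le zero_le_one (min_le_left _ _)
  have hsL : ∀ x y, |s x - s y| ≤ dist x y / R := fun x y => by
    have h1 : |s x - s y| ≤ |(2 - ‖x‖ / R) - (2 - ‖y‖ / R)| := by
      have h2 := abs_max_sub_max_le_max 0 (min 1 (2 - ‖x‖ / R)) 0 (min 1 (2 - ‖y‖ / R))
      have h3 := abs_min_sub_min_le_max 1 (2 - ‖x‖ / R) 1 (2 - ‖y‖ / R)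
      rw [sub_self, abs_zero] at h2 h3
      exact h2.trans ((max_eq_right (abs_nonneg _)).le.trans
        (h3.trans (max_eq_right (abs_nonneg _)).le))
    refine h1.trans ?_
    have h2 : (2 - ‖x‖ / R) - (2 - ‖y‖ / R) = (‖y‖ - ‖x‖) / R := by ring
    rw [h2, abs_div, abs_of_pos hR, dist_comm, dist_eq_norm]
    gcongr
    exact abs_norm_sub_norm_le y x
  have hL : LipschitzWith (1 + (1 + L)) fun x => x - s x • T x := by
    refine LipschitzWith.id.sub (LipschitzWith.of_dist_le_mul fun x y => ?_)
    have e : s x • T x - s y • T y = (s x - s y) • T x + s y • (T x - T y) := by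
      rw [sub_smul, smul_sub]; abel
    rw [dist_eq_norm, e]
    refine (norm_add_le _ _).trans ?_
    rw [norm_smul, norm_smul, Real.norm_eq_abs, Real.norm_of_nonneg (hs0 y), NNReal.coe_add,
      add_mul, NNReal.coe_one, one_mul]
    refine add_le_add ?_ ?_
    · calc |s x - s y| * ‖T x‖ ≤ dist x y / R * R := by
            gcongr
            exacts [hsL x y, hb x]
        _ = dist x y := by field_simp
    · calc s y * ‖T x - T y‖ ≤ 1 * (L * dist x y) := by
            gcongr
            exacts [hs1 y, by simpa [dist_eq_norm] using hT.dist_le_mul x y]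
        _ = L * dist x y := one_mul _
  obtain ⟨x, hx⟩ := exists_eq_zero_of_lipschitzWith hL (R := 2 * R) (by positivity) fun x hx => by
    have : s x = 0 := by
      have : 2 - ‖x‖ / R = 0 := by rw [hx]; field_simp; ring
      simp [s, this]
    rw [this, zero_smul, sub_zero]
  have hx : x = s x • T x := sub_eq_zero.1 hx
  have hxR : ‖x‖ ≤ R := by
    rw [hx, norm_smul, Real.norm_of_nonneg (hs0 x)]
    calc s x * ‖T x‖ ≤ 1 * R := by gcongr; exacts [hs1 x, hb x]
      _ = R := one_mul R
  have hsx : s x = 1 := by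
    have : 1 ≤ 2 - ‖x‖ / R := by
      have := (div_le_one hR).2 hxR
      linarith
    simp [s, this]
  rw [hsx, one_smul] at hx
  exact ⟨x, hx.symm⟩

/-- Existence of solutions of **variational inequalities** on compact convex sets. -/
theorem exists_variational_inequality [FiniteDimensional ℝ E] {K : Set E} (hc : IsCompact K)
    (hconv : Convex ℝ K) (hne : K.Nonempty) {g : E → E} {L : NNReal} (hg : LipschitzOnWith L g K) :
    ∃ x ∈ K, ∀ y ∈ K, inner ℝ (g x) (y - x) ≤ 0 := by
  obtain ⟨P, hPK, hPL, hP⟩ := exists_lipschitzWith_one_projection hne hc.isComplete hconv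
  obtain ⟨R, hR⟩ := hc.isBounded.exists_norm_le
  have hgP : LipschitzWith (L * 1) fun x => g (P x) := fun x y => by
    refine (hg (hPK x) (hPK y)).trans ?_
    rw [mul_one]
    gcongr
    simpa using hPL x y
  obtain ⟨x, hx⟩ := exists_fixedPoint_of_lipschitzWith (T := fun x => P (P x + g (P x)))
    (hPL.comp (hPL.add hgP)) (fun x => hR _ (hPK _))
  have hxK : x ∈ K := hx ▸ hPK _
  have hPx : P x = x := eq_of_inner_sub_projection_nonpos (hPK x) hxK (hP x) (by simp)
  simp only [hPx] at hx
  refine ⟨x, hxK, fun y hy => ?_⟩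
  have := hP (x + g x) y hy
  rwa [hx, add_sub_cancel_left] at this

end FixedPoint

/-! ### Stationary distributions and subharmonic functions -/

/-- A continuous-time Markov chain with rates `α` has a stationary distribution supported on the
set where a given subharmonic function `u` is maximal. -/
theorem exists_stationary_of_subharmonic {ι : Type*} [Fintype ι] [DecidableEq ι] [Nonempty ι]
    {α : ι → ι → ℝ} (hα : ∀ a d, 0 ≤ α a d) {u : ι → ℝ}
    (hu : ∀ a, 0 ≤ ∑ d, α a d * (u d - u a)) :
    ∃ τ ∈ stdSimplex ℝ ι, (∀ d, ∑ a, τ a * α a d = τ d * ∑ e, α d e) ∧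
      ∀ a, u a ≤ ∑ b, τ b * u b := by
  obtain ⟨m, hm⟩ := Finite.exists_max u
  -- `F d` is inflow minus outflow at `d`; on nonnegative vectors, `G ≤ 0` forces the support into
  -- the maximizers of `u`.
  let F : ι → (ι → ℝ) →ₗ[ℝ] ℝ := fun d =>
    ∑ a, α a d • LinearMap.proj a - (∑ e, α d e) • LinearMap.proj d
  let G : (ι → ℝ) →ₗ[ℝ] ℝ := ∑ b, (u m - u b) • LinearMap.proj b
  let A : ι ⊕ ι ⊕ ι ⊕ Unit → (ι → ℝ) →ₗ[ℝ] ℝ :=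
    Sum.elim (fun a => -LinearMap.proj a) (Sum.elim F (Sum.elim (fun d => -F d) fun _ => G))
  by_cases h : ∃ x, (∀ k, A k x ≤ 0) ∧ 0 < ∑ a, x a
  · obtain ⟨x, hx, hpos⟩ := h
    set s := ∑ a, x a with hs
    have hx0 : ∀ a, 0 ≤ x a := fun a => by simpa [A] using hx (.inl a)
    have hF : ∀ d, ∑ a, x a * α a d = x d * ∑ e, α d e := fun d => by
      have h1 := hx (.inr (.inl d))
      have h2 := hx (.inr (.inr (.inl d)))
      simp [A, F] at h1 h2
      have h3 := le_antisymm h1 h2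
      rw [mul_comm (x d), ← h3]
      exact Finset.sum_congr rfl fun a _ => mul_comm _ _
    have hG : s * u m ≤ ∑ b, x b * u b := by
      have h1 := hx (.inr (.inr (.inr ())))
      simp [A, G, sub_mul, Finset.sum_sub_distrib, ← Finset.mul_sum, ← hs] at h1
      rw [mul_comm]
      exact h1.trans_eq (Finset.sum_congr rfl fun a _ => mul_comm _ _)
    refine ⟨fun a => x a / s, ⟨fun a => div_nonneg (hx0 a) hpos.le, ?_⟩, fun d => ?_, fun a => ?_⟩
    · rw [← Finset.sum_div, div_self hpos.ne']
    · simp_rw [div_mul_eq_mul_div]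
      rw [← Finset.sum_div, hF]
    · simp_rw [div_mul_eq_mul_div]
      rw [← Finset.sum_div, le_div_iff₀ hpos]
      nlinarith [hm a]
  · exfalso
    push Not at h
    obtain ⟨w, hw, e⟩ := exists_nonneg_sum_smul_of_imp_nonpos A (∑ a, LinearMap.proj a)
      fun x hx => by simpa using h x hx
    -- The multipliers of `F` and `-F` combine into a potential `v` of arbitrary sign.
    let v : ι → ℝ := fun d => w (.inr (.inl d)) - w (.inr (.inr (.inl d)))
    have key : ∀ a, 1 ≤ ∑ d, α a d * (v d - v a) + w (.inr (.inr (.inr ()))) * (u m - u a) := by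
      intro a
      have hFa : ∀ d, F d (Pi.single a 1) = α a d - if d = a then ∑ e, α a e else 0 := fun d => by
        by_cases hd : d = a
        · subst hd; simp [F, Pi.single_apply]
        · simp [F, Pi.single_apply, hd]
      have hGa : G (Pi.single a 1) = u m - u a := by simp [G, Pi.single_apply]
      have h1 := LinearMap.congr_fun e (Pi.single a 1)
      simp [A, Fintype.sum_sum_type, Pi.single_apply, hFa, hGa] at h1
      have h2 := hw (.inl a)
      have h3 : ∑ d, α a d * (v d - v a)
          = ∑ d, w (.inr (.inl d)) * (α a d - if d = a then ∑ e, α a e else 0)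
            + -∑ d, w (.inr (.inr (.inl d))) * (α a d - if d = a then ∑ e, α a e else 0) := by
        simp only [mul_sub, Finset.sum_sub_distrib, mul_ite, mul_zero, Finset.sum_ite_eq',
          Finset.mem_univ, if_true, v, ← Finset.sum_mul]
        simp_rw [fun d => mul_comm (α a d)]
        ring
      linarith
    -- Subharmonicity forbids jumps from a maximizer of `u` to a non-maximizer. Where `v` is largest
    -- among the maximizers of `u`, its drift is thus nonpositive, against `key`.
    obtain ⟨a, ha, hmax⟩ := Finset.exists_max_image (Finset.univ.filter fun a => u a = u m) v
      ⟨m, by simp⟩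
    have ha : u a = u m := by simpa using ha
    have hle : ∀ d ∈ Finset.univ, α a d * (u d - u a) ≤ 0 := fun d _ =>
      mul_nonpos_of_nonneg_of_nonpos (hα a d) (by linarith [hm d])
    have hz := (Finset.sum_eq_zero_iff_of_nonpos hle).1
      (le_antisymm (Finset.sum_nonpos hle) (hu a))
    have h1 : ∑ d, α a d * (v d - v a) ≤ 0 := Finset.sum_nonpos fun d _ => by
      by_cases hd : u d = u m
      · exact mul_nonpos_of_nonneg_of_nonpos (hα a d) (by linarith [hmax d (by simp [hd])])
      · have h2 := hz d (Finset.mem_univ d)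
        rw [ha] at h2
        rw [(mul_eq_zero.1 h2).resolve_right (sub_ne_zero.2 hd), zero_mul]
    have h2 := key a
    rw [ha, sub_self, mul_zero] at h2
    linarith

/-! ### Payoffs, best responses and product distributions -/

namespace FiniteGame

variable {N : Type*} [Fintype N] [DecidableEq N] {C : N → Type*}

/-- The probability that the players other than `i` play according to `c`. -/
def othersProb (σ : ∀ i, C i → ℝ) (i : N) (c : ∀ i, C i) : ℝ :=
  ∏ j ∈ Finset.univ.erase i, σ j (c j)

theorem profileProb_eq_mul_othersProb (σ : ∀ i, C i → ℝ) (i : N) (c : ∀ i, C i) :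
    profileProb σ c = σ i (c i) * othersProb σ i c :=
  (Finset.mul_prod_erase _ _ (Finset.mem_univ i)).symm

theorem othersProb_update_left (σ : ∀ i, C i → ℝ) (i : N) (τ : C i → ℝ) (c : ∀ i, C i) :
    othersProb (Function.update σ i τ) i c = othersProb σ i c :=
  Finset.prod_congr rfl fun j hj => by rw [Function.update_of_ne (Finset.ne_of_mem_erase hj)]

theorem othersProb_update_right (σ : ∀ i, C i → ℝ) (i : N) (c : ∀ i, C i) (d : C i) :
    othersProb σ i (Function.update c i d) = othersProb σ i c :=
  Finset.prod_congr rfl fun j hj => by rw [Function.update_of_ne (Finset.ne_of_mem_erase hj)]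

variable [∀ i, Fintype (C i)]

theorem profileProb_mem_stdSimplex {σ : ∀ i, C i → ℝ} (h : ∀ i, σ i ∈ stdSimplex ℝ (C i)) :
    profileProb σ ∈ stdSimplex ℝ (∀ i, C i) := by
  refine ⟨fun c => Finset.prod_nonneg fun i _ => (h i).1 _, ?_⟩
  have := Finset.prod_univ_sum (fun i => (Finset.univ : Finset (C i))) (fun i a => σ i a)
  simp only [fun i => (h i).2, Finset.prod_const_one, Fintype.piFinset_univ] at this
  exact this.symm

variable [∀ i, DecidableEq (C i)]

/-- The expected utility of player `i` when she plays `a` and the others play according to `σ`. -/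
def payoff (U : N → (∀ i, C i) → ℝ) (σ : ∀ i, C i → ℝ) (i : N) (a : C i) : ℝ :=
  expectedUtility U i (Function.update σ i (pureStrategy a))

theorem sum_filter_update (i : N) (a d : C i) (f : (∀ j, C j) → ℝ) :
    ∑ c : (∀ j, C j) with c i = a, f (Function.update c i d)
      = ∑ c : (∀ j, C j) with c i = d, f c := by
  refine Finset.sum_nbij' (fun c => Function.update c i d) (fun c => Function.update c i a)
    ?_ ?_ ?_ ?_ ?_
  · simp
  · simp
  · simp +contextual [Finset.mem_filter, eq_comm]
  · simp +contextual [Finset.mem_filter, eq_comm]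
  · simp

theorem payoff_eq_sum (U : N → (∀ i, C i) → ℝ) (σ : ∀ i, C i → ℝ) (i : N) (a : C i) :
    payoff U σ i a = ∑ c : (∀ j, C j) with c i = a, othersProb σ i c * U i c := by
  rw [payoff, expectedUtility, Finset.sum_filter]
  refine Finset.sum_congr rfl fun c _ => ?_
  rw [profileProb_eq_mul_othersProb _ i, othersProb_update_left, Function.update_self, pureStrategy,
    Pi.single_apply]
  split_ifs <;> simp

theorem payoff_update (U : N → (∀ i, C i) → ℝ) (σ : ∀ i, C i → ℝ) (i : N) (τ : C i → ℝ) (a : C i) :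
    payoff U (Function.update σ i τ) i a = payoff U σ i a := by
  rw [payoff, payoff, Function.update_idem]

theorem expectedUtility_eq_sum_payoff (U : N → (∀ i, C i) → ℝ) (σ : ∀ i, C i → ℝ) (i : N) :
    expectedUtility U i σ = ∑ a, σ i a * payoff U σ i a := by
  rw [expectedUtility, ← Finset.sum_fiberwise (s := Finset.univ) (g := fun c : ∀ j, C j => c i)]
  refine Finset.sum_congr rfl fun a _ => ?_
  rw [payoff_eq_sum, Finset.mul_sum]
  refine Finset.sum_congr rfl fun c hc => ?_
  rw [profileProb_eq_mul_othersProb _ i, (Finset.mem_filter.1 hc).2, mul_assoc]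

theorem expectedUtility_update (U : N → (∀ i, C i) → ℝ) (σ : ∀ i, C i → ℝ) (i : N) (τ : C i → ℝ) :
    expectedUtility U i (Function.update σ i τ) = ∑ a, τ a * payoff U σ i a := by
  rw [expectedUtility_eq_sum_payoff]
  simp only [Function.update_self, payoff_update]

theorem sum_profileProb_mul_deviation (U : N → (∀ i, C i) → ℝ) (σ : ∀ i, C i → ℝ) (i : N)
    (a d : C i) :
    ∑ c : (∀ j, C j) with c i = a, profileProb σ c * (U i (Function.update c i d) - U i c)
      = σ i a * (payoff U σ i d - payoff U σ i a) := by
  rw [payoff_eq_sum U σ i d, ← sum_filter_update i a d, payoff_eq_sum, ← Finset.sum_sub_distrib,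
    Finset.mul_sum]
  refine Finset.sum_congr rfl fun c hc => ?_
  rw [profileProb_eq_mul_othersProb _ i, (Finset.mem_filter.1 hc).2, othersProb_update_right]
  ring

theorem marginal_profileProb {σ : ∀ i, C i → ℝ} (h : ∀ i, σ i ∈ stdSimplex ℝ (C i)) (i : N)
    (a : C i) : marginal (profileProb σ) i a = σ i a := by
  -- With utility constantly 1, the payoff formula says that `othersProb` sums to 1 over the
  -- profiles with `c i = a`.
  have h1 := payoff_eq_sum (fun (_ : N) (_ : ∀ i, C i) => (1 : ℝ)) σ i a
  have h2 : ∀ j, Function.update σ i (pureStrategy a) j ∈ stdSimplex ℝ (C j) := fun j => by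
    rcases eq_or_ne j i with rfl | hj
    · rw [Function.update_self]
      exact single_mem_stdSimplex ℝ a
    · rw [Function.update_of_ne hj]
      exact h j
  simp only [payoff, expectedUtility, mul_one, (profileProb_mem_stdSimplex h2).2] at h1
  rw [marginal, Finset.sum_congr rfl fun c hc => by
    rw [profileProb_eq_mul_othersProb _ i, (Finset.mem_filter.1 hc).2], ← Finset.mul_sum, ← h1,
    mul_one]

theorem IsBestResponse.payoff_le {U : N → (∀ i, C i) → ℝ} {σ : ∀ i, C i → ℝ} {i : N} {τ : C i → ℝ}
    (h : IsBestResponse U σ i τ) (a : C i) : payoff U σ i a ≤ ∑ b, τ b * payoff U σ i b := by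
  rw [← expectedUtility_update]
  exact h.2 _ (single_mem_stdSimplex ℝ a)

theorem IsBestResponse.payoff_le_of_pureStrategy {U : N → (∀ i, C i) → ℝ} {σ : ∀ i, C i → ℝ} {i : N}
    {b : C i} (h : IsBestResponse U σ i (pureStrategy b)) (a : C i) :
    payoff U σ i a ≤ payoff U σ i b := by
  simpa [pureStrategy, Pi.single_apply] using h.payoff_le a

theorem isBestResponse_of_payoff_le {U : N → (∀ i, C i) → ℝ} {σ : ∀ i, C i → ℝ} {i : N}
    {τ : C i → ℝ} (hτ : τ ∈ stdSimplex ℝ (C i))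
    (h : ∀ a, payoff U σ i a ≤ ∑ b, τ b * payoff U σ i b) : IsBestResponse U σ i τ := by
  refine ⟨hτ, fun τ' hτ' => ?_⟩
  rw [expectedUtility_update, expectedUtility_update]
  calc ∑ a, τ' a * payoff U σ i a ≤ ∑ a, τ' a * ∑ b, τ b * payoff U σ i b :=
        Finset.sum_le_sum fun a _ => mul_le_mul_of_nonneg_left (h a) (hτ'.1 a)
    _ = _ := by rw [← Finset.sum_mul, hτ'.2, one_mul]

/-- The gaps below the mean payoff `m` are nonnegative and average to zero under `τ`, so they vanish
on its support. -/
theorem IsBestResponse.payoff_le_of_pos {U : N → (∀ i, C i) → ℝ} {σ : ∀ i, C i → ℝ} {i : N}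
    {τ : C i → ℝ} (h : IsBestResponse U σ i τ) {b : C i} (hb : 0 < τ b) (a : C i) :
    payoff U σ i a ≤ payoff U σ i b := by
  refine (h.payoff_le a).trans ?_
  set m := ∑ b, τ b * payoff U σ i b with hm
  have h1 : ∑ c, τ c * (m - payoff U σ i c) = 0 := by
    simp only [mul_sub, Finset.sum_sub_distrib, ← Finset.sum_mul, h.1.2, one_mul, ← hm, sub_self]
  have h2 := (Finset.sum_eq_zero_iff_of_nonneg fun c _ =>
    mul_nonneg (h.1.1 c) (sub_nonneg.2 (h.payoff_le c))).1 h1 b (Finset.mem_univ b)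
  exact (sub_eq_zero.1 ((mul_eq_zero.1 h2).resolve_left hb.ne')).le

theorem IsNashEquilibrium.isCorrelatedEquilibrium {U : N → (∀ i, C i) → ℝ} {σ : ∀ i, C i → ℝ}
    (h : IsNashEquilibrium U σ) : IsCorrelatedEquilibrium U (profileProb σ) := by
  refine ⟨profileProb_mem_stdSimplex h.1, fun i a d => ?_⟩
  rw [sum_profileProb_mul_deviation]
  rcases ((h.1 i).1 a).eq_or_lt with h0 | h0
  · rw [← h0, zero_mul]
  · exact mul_nonpos_of_nonneg_of_nonpos h0.le
      (sub_nonpos.2 ((h.2 i).payoff_le_of_pos h0 d))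

end FiniteGame

/-! ### Confined equilibria, dual deviation rates and the theorem -/

namespace FiniteGame

variable {N : Type*} [Fintype N] [DecidableEq N] {C : N → Type*}
  [∀ i, Fintype (C i)] [∀ i, DecidableEq (C i)]

/-- Nash's existence theorem for a finite game whose players are confined to compact convex sets of
mixed strategies. -/
theorem exists_equilibrium_of_isCompact_convex (U : N → (∀ i, C i) → ℝ) {S : ∀ i, Set (C i → ℝ)}
    (hc : ∀ i, IsCompact (S i)) (hconv : ∀ i, Convex ℝ (S i)) (hne : ∀ i, (S i).Nonempty) :
    ∃ σ : ∀ i, C i → ℝ, (∀ i, σ i ∈ S i) ∧ ∀ i, ∀ τ ∈ S i,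
      ∑ a, τ a * payoff U σ i a ≤ ∑ a, σ i a * payoff U σ i a := by
  let f : (∀ i, C i → ℝ) → EuclideanSpace ℝ (Σ i, C i) := fun σ =>
    WithLp.toLp 2 fun p => σ p.1 p.2
  let g : EuclideanSpace ℝ (Σ i, C i) → EuclideanSpace ℝ (Σ i, C i) := fun x =>
    f (payoff U fun i a => x ⟨i, a⟩)
  have hf : IsLinearMap ℝ f := ⟨fun _ _ => rfl, fun _ _ => rfl⟩
  have hfc : Continuous f := by
    refine (PiLp.continuous_toLp 2 _).comp (continuous_pi fun p => ?_)
    fun_prop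
  let K := f '' Set.univ.pi S
  have hK : IsCompact K := (isCompact_univ_pi hc).image hfc
  have hKc : Convex ℝ K := (convex_pi fun i _ => hconv i).is_linear_image hf
  have hKne : K.Nonempty := (Set.univ_pi_nonempty_iff.2 hne).image f
  -- The payoff field is polynomial in the strategies, hence Lipschitz on the compact convex set
  -- `K`. Its variational inequality, tested on changes of one player's strategy, is the equilibrium
  -- condition.
  have hg : ContDiff ℝ 1 g := by
    rw [contDiff_euclidean]
    rintro ⟨i, a⟩
    simp only [g, f, payoff_eq_sum, othersProb]
    refine ContDiff.sum fun c _ => ContDiff.mul (contDiff_prod fun j _ => ?_) contDiff_const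
    fun_prop
  obtain ⟨L, hL⟩ := hg.contDiffOn.exists_lipschitzOnWith one_ne_zero hKc hK
  obtain ⟨x, ⟨σ, hσ, rfl⟩, hx⟩ := exists_variational_inequality hK hKc hKne hL
  have hσ : ∀ i, σ i ∈ S i := fun i => hσ i (Set.mem_univ i)
  refine ⟨σ, hσ, fun i τ hτ => ?_⟩
  have h1 := hx (f (Function.update σ i τ)) ⟨_, fun j _ => by
    rcases eq_or_ne j i with rfl | hj
    · simpa using hτ
    · simpa [hj] using hσ j, rfl⟩
  have h2 : inner ℝ (g (f σ)) (f (Function.update σ i τ) - f σ)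
      = ∑ j, ∑ a, (Function.update σ i τ j a - σ j a) * payoff U σ j a := by
    rw [PiLp.inner_apply, Fintype.sum_sigma]
    rfl
  rw [h2, Finset.sum_eq_single i (fun j _ hj => by simp [hj]) (by simp)] at h1
  simp only [Function.update_self, sub_mul, Finset.sum_sub_distrib] at h1
  linarith

/-- The total gain of the players when each player `i` deviates from `c i` to `d` at rate
`α i (c i) d`. -/
def deviationGain (U : N → (∀ i, C i) → ℝ) (α : ∀ i, C i → C i → ℝ) (c : ∀ i, C i) : ℝ :=
  ∑ i, ∑ d, α i (c i) d * (U i (Function.update c i d) - U i c)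

/-- By rescaling, the homogeneous constraints already force `μ c₀ ≤ 0`. Farkas' lemma writes this as
a combination of incentive constraints, whose multipliers are `α`, and of sign constraints, whose
multipliers are the slack at each profile. -/
theorem exists_deviationGain_pos (U : N → (∀ i, C i) → ℝ) (c₀ : ∀ i, C i)
    (h0 : ∀ μ, IsCorrelatedEquilibrium U μ → μ c₀ = 0) :
    ∃ α : ∀ i, C i → C i → ℝ, (∀ i a d, 0 ≤ α i a d) ∧ (∀ c, 0 ≤ deviationGain U α c) ∧
      0 < deviationGain U α c₀ := by
  let H : (Σ i, C i × C i) → ((∀ i, C i) → ℝ) →ₗ[ℝ] ℝ := fun p =>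
    ∑ c : (∀ j, C j) with c p.1 = p.2.1,
      (U p.1 (Function.update c p.1 p.2.2) - U p.1 c) • LinearMap.proj c
  have hH : ∀ i a d μ, H ⟨i, a, d⟩ μ = ∑ c : (∀ j, C j) with c i = a,
      μ c * (U i (Function.update c i d) - U i c) := fun i a d μ => by
    simp only [H, LinearMap.sum_apply, LinearMap.smul_apply, LinearMap.proj_apply, smul_eq_mul]
    exact Finset.sum_congr rfl fun c _ => mul_comm _ _
  obtain ⟨w, hw, e⟩ := exists_nonneg_sum_smul_of_imp_nonpos
    (Sum.elim H fun c => -LinearMap.proj c) (LinearMap.proj c₀) fun μ hμ => by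
      have hμ0 : ∀ c, 0 ≤ μ c := fun c => by simpa using hμ (.inr c)
      rw [LinearMap.proj_apply]
      by_contra! hpos
      have hs : 0 < ∑ c, μ c :=
        Finset.sum_pos' (fun c _ => hμ0 c) ⟨c₀, Finset.mem_univ _, hpos⟩
      have h1 := h0 (fun c => μ c / ∑ c, μ c) ⟨⟨fun c => div_nonneg (hμ0 c) hs.le, by
        rw [← Finset.sum_div, div_self hs.ne']⟩, fun i a d => by
          simp_rw [div_mul_eq_mul_div]
          rw [← Finset.sum_div, ← hH]
          exact div_nonpos_of_nonpos_of_nonneg (hμ (.inl ⟨i, a, d⟩)) hs.le⟩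
      exact (div_pos hpos hs).ne' h1
  have key : ∀ c, (if c = c₀ then 1 else 0)
      ≤ deviationGain U (fun i a d => w (.inl ⟨i, a, d⟩)) c := fun c => by
    have h1 := LinearMap.congr_fun e (Pi.single c 1)
    simp only [LinearMap.proj_apply, Fintype.sum_sum_type, LinearMap.add_apply,
      LinearMap.sum_apply, LinearMap.smul_apply, Sum.elim_inl, Sum.elim_inr, LinearMap.neg_apply,
      smul_eq_mul, Fintype.sum_sigma, Fintype.sum_prod_type, hH, Pi.single_apply, ite_mul, one_mul,
      zero_mul, mul_neg, mul_ite, mul_one, mul_zero, Finset.sum_ite_eq', Finset.mem_filter,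
      Finset.mem_univ, true_and, Finset.sum_neg_distrib, if_true] at h1
    have h2 : deviationGain U (fun i a d => w (.inl ⟨i, a, d⟩)) c
        = (if c₀ = c then 1 else 0) + w (.inr c) := by
      rw [h1, deviationGain]
      simp
    rw [h2]
    have := hw (.inr c)
    simp only [eq_comm (a := c)]
    linarith
  refine ⟨fun i a d => w (.inl ⟨i, a, d⟩), fun _ _ _ => hw _, fun c => ?_, ?_⟩
  · refine le_trans ?_ (key c)
    split_ifs <;> norm_num
  · simpa using (zero_lt_one (α := ℝ)).trans_le (by simpa using key c₀)

/-- A dual vector for the correlated equilibrium constraints satisfying strict complementarity. -/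
theorem exists_strictly_complementary_deviationGain (U : N → (∀ i, C i) → ℝ) :
    ∃ α : ∀ i, C i → C i → ℝ, (∀ i a d, 0 ≤ α i a d) ∧ (∀ c, 0 ≤ deviationGain U α c) ∧
      ∀ c, (∀ μ, IsCorrelatedEquilibrium U μ → μ c = 0) → 0 < deviationGain U α c := by
  have h : ∀ c₀ : ∀ i, C i, ∃ α : ∀ i, C i → C i → ℝ, (∀ i a d, 0 ≤ α i a d) ∧
      (∀ c, 0 ≤ deviationGain U α c) ∧
      ((∀ μ, IsCorrelatedEquilibrium U μ → μ c₀ = 0) → 0 < deviationGain U α c₀) := fun c₀ => by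
    by_cases h0 : ∀ μ, IsCorrelatedEquilibrium U μ → μ c₀ = 0
    · obtain ⟨α, h1, h2, h3⟩ := exists_deviationGain_pos U c₀ h0
      exact ⟨α, h1, h2, fun _ => h3⟩
    · exact ⟨0, fun _ _ _ => le_rfl, fun c => by simp [deviationGain], fun h => absurd h h0⟩
  choose α h1 h2 h3 using h
  have hsum : ∀ c, deviationGain U (fun i a d => ∑ c₀, α c₀ i a d) c
      = ∑ c₀, deviationGain U (α c₀) c := fun c => by
    simp only [deviationGain, Finset.sum_mul]
    rw [Finset.sum_comm]
    refine Finset.sum_congr rfl fun i _ => ?_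
    rw [Finset.sum_comm]
  -- The gain is additive in the rates, so the sum over all `c₀` is positive wherever one summand
  -- is.
  refine ⟨fun i a d => ∑ c₀, α c₀ i a d, fun i a d => Finset.sum_nonneg fun c _ => h1 c i a d,
    fun c => ?_, fun c hc => ?_⟩
  · rw [hsum]
    exact Finset.sum_nonneg fun c₀ _ => h2 c₀ c
  · rw [hsum]
    exact Finset.sum_pos' (fun c₀ _ => h2 c₀ c) ⟨c, Finset.mem_univ c, h3 c hc⟩

theorem sum_profileProb_mul_deviationGain (U : N → (∀ i, C i) → ℝ) (α : ∀ i, C i → C i → ℝ)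
    (σ : ∀ i, C i → ℝ) :
    ∑ c, profileProb σ c * deviationGain U α c
      = ∑ i, ∑ a, σ i a * ∑ d, α i a d * (payoff U σ i d - payoff U σ i a) := by
  simp only [deviationGain, Finset.mul_sum]
  rw [Finset.sum_comm]
  refine Finset.sum_congr rfl fun i _ => ?_
  rw [← Finset.sum_fiberwise (s := Finset.univ) (g := fun c : ∀ j, C j => c i)]
  refine Finset.sum_congr rfl fun a _ => ?_
  rw [Finset.sum_comm]
  refine Finset.sum_congr rfl fun d _ => ?_
  rw [mul_left_comm, ← sum_profileProb_mul_deviation, Finset.mul_sum]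
  refine Finset.sum_congr rfl fun c hc => ?_
  rw [(Finset.mem_filter.1 hc).2]
  ring

/-- The mixed strategies of a player that are stationary under the deviation rates `α`. -/
def stationaryStrategies {ι : Type*} [Fintype ι] (α : ι → ι → ℝ) : Set (ι → ℝ) :=
  {τ | τ ∈ stdSimplex ℝ ι ∧ ∀ d, ∑ a, τ a * α a d = τ d * ∑ e, α d e}

theorem isCompact_stationaryStrategies {ι : Type*} [Fintype ι] (α : ι → ι → ℝ) :
    IsCompact (stationaryStrategies α) := by
  have h : stationaryStrategies α
      = stdSimplex ℝ ι ∩ ⋂ d, {τ | ∑ a, τ a * α a d = τ d * ∑ e, α d e} := by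
    ext
    simp [stationaryStrategies]
  rw [h]
  refine (isCompact_stdSimplex ℝ ι).inter_right ?_
  exact isClosed_iInter fun d => isClosed_eq (by fun_prop) (by fun_prop)

theorem convex_stationaryStrategies {ι : Type*} [Fintype ι] (α : ι → ι → ℝ) :
    Convex ℝ (stationaryStrategies α) := by
  intro x hx y hy s t hs ht hst
  refine ⟨convex_stdSimplex ℝ ι hx.1 hy.1 hs ht hst, fun d => ?_⟩
  simp only [Pi.add_apply, Pi.smul_apply, smul_eq_mul, add_mul, Finset.sum_add_distrib, mul_assoc,
    ← Finset.mul_sum, hx.2 d, hy.2 d]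

/-- In a stationary distribution the mean drift of any function is zero, since inflow balances
outflow at each state. -/
theorem sum_stationary_mul_generator {ι : Type*} [Fintype ι] {α : ι → ι → ℝ} {τ : ι → ℝ}
    (hτ : τ ∈ stationaryStrategies α) (u : ι → ℝ) :
    ∑ a, τ a * ∑ d, α a d * (u d - u a) = 0 := by
  have h1 : ∑ a, τ a * ∑ d, α a d * (u d - u a)
      = ∑ d, u d * ∑ a, τ a * α a d - ∑ a, u a * (τ a * ∑ d, α a d) := by
    simp only [mul_sub, Finset.sum_sub_distrib, Finset.mul_sum]
    congr 1
    · rw [Finset.sum_comm]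
      exact Finset.sum_congr rfl fun d _ => Finset.sum_congr rfl fun a _ => by ring
    · exact Finset.sum_congr rfl fun d _ => Finset.sum_congr rfl fun a _ => by ring
  rw [h1, sub_eq_zero]
  exact Finset.sum_congr rfl fun d _ => by rw [hτ.2]

/-- If all opponents of `i` play stationary strategies, then the total expected gain from
deviations when `i` plays `a` is the gain of `i`. -/
theorem sum_profileProb_update_mul_deviationGain (U : N → (∀ i, C i) → ℝ)
    (α : ∀ i, C i → C i → ℝ) {σ : ∀ i, C i → ℝ} (hσ : ∀ i, σ i ∈ stationaryStrategies (α i)) (i : N)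
    (a : C i) :
    ∑ c, profileProb (Function.update σ i (pureStrategy a)) c * deviationGain U α c
      = ∑ d, α i a d * (payoff U σ i d - payoff U σ i a) := by
  rw [sum_profileProb_mul_deviationGain, Finset.sum_eq_single i (fun j _ hj => ?_) (by simp)]
  · simp only [Function.update_self, payoff_update]
    simp [pureStrategy, Pi.single_apply]
  · rw [Function.update_of_ne hj]
    exact sum_stationary_mul_generator (hσ j) _

/-- There is a Nash equilibrium against which no strategy of zero marginal probability in all
correlated equilibria is a best response. -/
theorem exists_isNashEquilibrium_not_isBestResponse [∀ i, Nonempty (C i)]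
    (U : N → (∀ i, C i) → ℝ) :
    ∃ σ : ∀ i, C i → ℝ, IsNashEquilibrium U σ ∧ ∀ i, ∀ a : C i,
      (∀ μ, IsCorrelatedEquilibrium U μ → marginal μ i a = 0) →
        ¬ IsBestResponse U σ i (pureStrategy a) := by
  obtain ⟨α, hα, hgain, hpos⟩ := exists_strictly_complementary_deviationGain U
  obtain ⟨σ, hσ, hmax⟩ := exists_equilibrium_of_isCompact_convex U
    (fun i => isCompact_stationaryStrategies (α i)) (fun i => convex_stationaryStrategies (α i))
    fun i => by
      obtain ⟨τ, h1, h2, -⟩ := exists_stationary_of_subharmonic (hα i) (u := 0) (by simp)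
      exact ⟨τ, h1, h2⟩
  have hupd : ∀ i (a : C i), profileProb (Function.update σ i (pureStrategy a)) ∈
      stdSimplex ℝ (∀ i, C i) := fun i a => profileProb_mem_stdSimplex fun j => by
    rcases eq_or_ne j i with rfl | hj
    · rw [Function.update_self]
      exact single_mem_stdSimplex ℝ a
    · rw [Function.update_of_ne hj]
      exact (hσ j).1
  refine ⟨σ, ⟨fun i => (hσ i).1, fun i => isBestResponse_of_payoff_le (hσ i).1 fun a => ?_⟩,
    fun i a ha hbr => ?_⟩
  -- With stationary opponents, the drift of the payoff at `a` is an expected total gain, hence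
  -- nonnegative.
  · obtain ⟨τ, h1, h2, h3⟩ := exists_stationary_of_subharmonic (hα i) (u := payoff U σ i)
      fun a => by
        rw [← sum_profileProb_update_mul_deviationGain U α hσ]
        exact Finset.sum_nonneg fun c _ => mul_nonneg ((hupd i a).1 c) (hgain c)
    exact (h3 a).trans (hmax i τ ⟨h1, h2⟩)
  -- A best response `a` makes this drift nonpositive, so the expected gain is zero although the
  -- gain is positive at every profile with `c i = a`; no profile would then carry any mass.
  · have hle : ∑ d, α i a d * (payoff U σ i d - payoff U σ i a) ≤ 0 :=
      Finset.sum_nonpos fun d _ => mul_nonpos_of_nonneg_of_nonpos (hα i a d)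
        (sub_nonpos.2 (hbr.payoff_le_of_pureStrategy d))
    rw [← sum_profileProb_update_mul_deviationGain U α hσ] at hle
    have hnn : ∀ c ∈ Finset.univ,
        0 ≤ profileProb (Function.update σ i (pureStrategy a)) c * deviationGain U α c :=
      fun c _ => mul_nonneg ((hupd i a).1 c) (hgain c)
    have hz := (Finset.sum_eq_zero_iff_of_nonneg hnn).1
      (le_antisymm hle (Finset.sum_nonneg hnn))
    have h0 : ∀ c, profileProb (Function.update σ i (pureStrategy a)) c = 0 := fun c => by
      by_cases hc : c i = a
      · refine (mul_eq_zero.1 (hz c (Finset.mem_univ c))).resolve_right (hpos c fun μ hμ => ?_).ne'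
        exact (Finset.sum_eq_zero_iff_of_nonneg fun c _ => hμ.1.1 c).1 (ha μ hμ) c (by simp [hc])
      · rw [profileProb_eq_mul_othersProb _ i, Function.update_self, pureStrategy,
          Pi.single_eq_of_ne hc, zero_mul]
    have h1 := (hupd i a).2
    simp [h0] at h1

end FiniteGame

theorem mainTheorem2 {N : Type*} [Fintype N] [DecidableEq N] {C : N → Type*}
    [∀ i, Fintype (C i)] [∀ i, DecidableEq (C i)] [∀ i, Nonempty (C i)]
    (U : N → (∀ i, C i) → ℝ) :
    (∃ σ : ∀ i, C i → ℝ, FiniteGame.IsNashEquilibrium U σ ∧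
      ∀ i, ∀ a : C i,
        (∀ μ, FiniteGame.IsCorrelatedEquilibrium U μ → FiniteGame.marginal μ i a = 0) →
          ¬ FiniteGame.IsBestResponse U σ i (FiniteGame.pureStrategy a)) ∧
    (∀ μ, FiniteGame.IsCorrelatedEquilibrium U μ →
      (∀ ν, FiniteGame.IsCorrelatedEquilibrium U ν → ν = μ) →
        ∃ σ : ∀ i, C i → ℝ, FiniteGame.IsQuasiStrict U σ ∧ FiniteGame.profileProb σ = μ) := by
  have h := FiniteGame.exists_isNashEquilibrium_not_isBestResponse U
  refine ⟨h, fun μ _ huniq => ?_⟩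
  obtain ⟨σ, hσ, hbr⟩ := h
  have e := huniq _ hσ.isCorrelatedEquilibrium
  refine ⟨σ, ⟨hσ, fun i a ha => ((hσ.1 i).1 a).lt_of_ne fun h0 => ?_⟩, e⟩
  refine hbr i a (fun ν hν => ?_) ha
  rw [huniq ν hν, ← e, FiniteGame.marginal_profileProb hσ.1, ← h0]
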